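/- **Setting.** Let $(\Omega,\mathcal F,\mathbb P)$ be a complete probability space with a filtration $\{\mathcal F_t\}_{t\ge 0}$ satisfying the usual conditions, $W$ a scalar Brownian motion with respect to $\{\mathcal F_t\}$, and $f,g:\mathbb R^d\to\mathbb R^d$ measurable. For each $x_0\in\mathbb R^d$ let $x(t,x_0)$, $t\ge 0$, be a (continuous, adapted) solution of the Itô SDE $$dx(t)=f(x(t))\,dt+g(x(t))\,dW(t),\qquad x(0)=x_0 .$$ Let $h^*>0$. For each step size $h\in(0,h^*]$ and each $x_0\in\mathbb R^d$ let $X^{h,x_0}_k$, $k=0,1,2,\dots$, be $\mathbb R^d$-valued random variables on $\Omega$ with $X^{h,x_0}_0=x_0$ a.s. (the numerical solution). Let $p,q,r_1>0$ be constants, $\Psi:[0,\infty)\to\mathbb R$ a continuous function, and $(C_T)_{T>0}$ real constants. Assume: * (i) For each $h\in(0,h^*]$ the numerical solution is a time-homogeneous Markov process: there is a transition kernel $\kappa_h$ on $\mathbb R^d$ with $\mathbb P(X^{h,x_0}_{k+1}\in B\mid \sigma(X^{h,x_0}_0,\dots,X^{h,x_0}_k))=\kappa_h(X^{h,x_0}_k,B)$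 a.s. for all $x_0$, all $k$ and all Borel sets $B$. * (ii) For every compact $K\subset\mathbb R^d$ there is $M_1>0$ with $\mathbb E|x(t,x_0)-x(t,y_0)|^p\le |x_0-y_0|^p e^{-M_1t}$ for all $x_0,y_0\in K$ and $t\ge0$. * (iii) For all $T>0$, all integers $n\ge1$ with $h:=T/n\le h^*$, all $j=1,\dots,n$ and all $x_0\in\mathbb R^d$, $\mathbb E|x(jh,x_0)-X^{h,x_0}_j|^p\le C_T\,\Psi(|x_0|^{r_1})\,h^q$. * (iv) For every $x_0$ there is $M_2$ (depending on $x_0$ but not on $h$, $k$) with $\mathbb E|X^{h,x_0}_k|^{r_1}\le M_2$ for all $h\in(0,h^*]$ and $k\ge 0$. * (v) For every $x_0$ there is $M_5$ with $\mathbb E|x(t,x_0)|^p\le M_5$ for all $t\ge0$. For probability measures $\mu,\nu$ on $\mathbb R^d$ put $d_{\mathbb L}(\mu,\nu)=\sup_F\left|\int F\,d\mu-\int F\,d\nu\right|$, the supremum being over all $F:\mathbb R^d\to\mathbb R$ with $|F(x)-F(y)|\le|x-y|$ and $|F(x)|\le1$ for all $x,y$. A probability measure $\pi$ on $\mathbb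 R^d$ is called a stationary distribution of the SDE if for every $x_0\in\mathbb R^d$ the law $\overline{\mathbb P}_t(x_0,\cdot)$ of $x(t,x_0)$ satisfies $d_{\mathbb L}(\overline{\mathbb P}_t(x_0,\cdot),\pi)\to0$ as $t\to\infty$. **Theorem.** The SDE has exactly one stationary distribution $\pi$. Moreover, for every $x_0\in\mathbb R^d$, with $\mathbb P^h_j(x_0,\cdot)$ denoting the law of $X^{h,x_0}_j$, $$\lim_{jh\to\infty,\ h\to0} d_{\mathbb L}\big(\mathbb P^h_j(x_0,\cdot),\pi\big)=0$$ (that is, for every $\varepsilon>0$ there are $\tau\ge 0$ and $\delta\in(0,h^*]$ such that $d_{\mathbb L}(\mathbb P^h_j(x_0,\cdot),\pi)<\varepsilon$ whenever $0<h\le\delta$ and $jh\ge\tau$) in each of the following two senses: * for every fixed $T>0$, with $h$ restricted to the step sizes $h=T/n$, $n=1,2,\dots$; * without any restriction on the step sizes $h$, if $T\mapsto C_T$ is bounded on compact subintervals of $(0,\infty)$ (in particular, if $C_T$ is nonnegative and nondecreasing in $T$). -/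

import Mathlib

open MeasureTheory ProbabilityTheory Filter Topology Set
open scoped NNReal ENNReal

noncomputable section

/-! ### Itô stochastic differential equations driven by a scalar Brownian motion -/

section SDE

variable {Ω : Type*} {mΩ : MeasurableSpace Ω} {d : ℕ}

/-- `W` is a scalar Brownian motion relative to the filtration `𝓕`: a Brownian motion that is
adapted to `𝓕` and whose increments after time `s` are independent of `𝓕 s`. -/
structure IsBrownianMotionWrt (𝓕 : Filtration ℝ≥0 mΩ) (W : ℝ≥0 → Ω → ℝ) (P : Measure Ω) :
    Prop where
  brownian : IsBrownianReal W P
  adapted : StronglyAdapted 𝓕 W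
  indep : ∀ s t : ℝ≥0, s ≤ t →
    Indep (𝓕 s) (MeasurableSpace.comap (fun ω => W t ω - W s ω) inferInstance) P

/-- A bounded simple `ℝᵈ`-valued integrand, equal to `val i` on `(time i, time (i + 1)]` for
`i < len` and to `0` elsewhere, where `val i` is measurable with respect to `𝓕 (time i)`. -/
structure SimpleIntegrand (𝓕 : Filtration ℝ≥0 mΩ) (d : ℕ) where
  len : ℕ
  time : ℕ → ℝ≥0
  time_mono : Monotone time
  val : ℕ → Ω → EuclideanSpace ℝ (Fin d)
  val_meas : ∀ i, StronglyMeasurable[𝓕 (time i)] (val i)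
  val_bdd : ∃ c : ℝ, ∀ i ω, ‖val i ω‖ ≤ c

/-- The value of a simple integrand at time `s`. -/
def SimpleIntegrand.eval {𝓕 : Filtration ℝ≥0 mΩ} (S : SimpleIntegrand 𝓕 d) (s : ℝ≥0) (ω : Ω) :
    EuclideanSpace ℝ (Fin d) :=
  ∑ i ∈ Finset.range S.len, (Ioc (S.time i) (S.time (i + 1))).indicator (fun _ => S.val i ω) s

/-- The elementary stochastic integral `∫₀ᵗ S dW` of a simple integrand. -/
def SimpleIntegrand.integral {𝓕 : Filtration ℝ≥0 mΩ} (S : SimpleIntegrand 𝓕 d)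
    (W : ℝ≥0 → Ω → ℝ) (t : ℝ≥0) (ω : Ω) : EuclideanSpace ℝ (Fin d) :=
  ∑ i ∈ Finset.range S.len,
    (W (min t (S.time (i + 1))) ω - W (min t (S.time i)) ω) • S.val i ω

/-- `I` is (a continuous version of) the Itô integral `I t = ∫₀ᵗ G s dW s`: it is adapted and
continuous, and there are simple integrands `S n` such that, for every horizon `T`,
`∫₀ᵀ |S n - G|² ds → 0` in probability and `sup_{t ≤ T} |∫₀ᵗ S n dW - I t| → 0` in probability. -/
def IsItoIntegral (𝓕 : Filtration ℝ≥0 mΩ) (W : ℝ≥0 → Ω → ℝ) (P : Measure Ω)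
    (G I : ℝ≥0 → Ω → EuclideanSpace ℝ (Fin d)) : Prop :=
  StronglyAdapted 𝓕 I ∧ (∀ᵐ ω ∂P, Continuous fun t => I t ω) ∧
  ∃ S : ℕ → SimpleIntegrand 𝓕 d, ∀ T : ℝ≥0, ∀ ε : ℝ≥0∞, 0 < ε →
    Tendsto (fun n => P {ω | ε ≤ ∫⁻ s in Icc (0 : ℝ) T,
      ‖(S n).eval s.toNNReal ω - G s.toNNReal ω‖ₑ ^ 2}) atTop (𝓝 0) ∧
    Tendsto (fun n => P {ω | ε ≤ ⨆ t ∈ Icc 0 T, ‖(S n).integral W t ω - I t ω‖ₑ}) atTop (𝓝 0)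

/-- `x` is a (strong) solution on `[0, ∞)` of the Itô equation
`dx(t) = f(x(t)) dt + g(x(t)) dW(t)` with `x(0) = x₀`: an adapted continuous process such that,
almost surely, `x(t) = x₀ + ∫₀ᵗ f(x(s)) ds + ∫₀ᵗ g(x(s)) dW(s)` for all `t`. -/
structure IsSDESolution (𝓕 : Filtration ℝ≥0 mΩ) (W : ℝ≥0 → Ω → ℝ) (P : Measure Ω)
    (f g : EuclideanSpace ℝ (Fin d) → EuclideanSpace ℝ (Fin d)) (x₀ : EuclideanSpace ℝ (Fin d))
    (x : ℝ≥0 → Ω → EuclideanSpace ℝ (Fin d)) : Prop where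
  adapted : StronglyAdapted 𝓕 x
  continuous : ∀ᵐ ω ∂P, Continuous fun t => x t ω
  drift_integrable : ∀ᵐ ω ∂P, ∀ t : ℝ≥0, IntegrableOn (fun s : ℝ => f (x s.toNNReal ω)) (Icc 0 t)
  diffusion_sq_integrable :
    ∀ᵐ ω ∂P, ∀ t : ℝ≥0, IntegrableOn (fun s : ℝ => ‖g (x s.toNNReal ω)‖ ^ 2) (Icc 0 t)
  equation : ∃ I : ℝ≥0 → Ω → EuclideanSpace ℝ (Fin d),
    IsItoIntegral 𝓕 W P (fun s ω => g (x s ω)) I ∧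
    ∀ᵐ ω ∂P, ∀ t : ℝ≥0, x t ω = x₀ + (∫ s in Icc (0 : ℝ) t, f (x s.toNNReal ω)) + I t ω

end SDE

/-! ### Time-homogeneous Markov chains, moment conditions -/

section Conditions

variable {Ω : Type*} {mΩ : MeasurableSpace Ω} {d : ℕ}

/-- The family of discrete-time processes `Y y`, started at the points `y`, is a time-homogeneous
Markov process: there is one transition kernel `κ`, the same for all times and starting points,
with `P(Y y (k + 1) ∈ B | σ(Y y 0, …, Y y k)) = κ (Y y k) B` almost surely. -/
def IsHomogeneousMarkov (P : Measure Ω)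
    (Y : EuclideanSpace ℝ (Fin d) → ℕ → Ω → EuclideanSpace ℝ (Fin d)) : Prop :=
  (∀ y k, Measurable (Y y k)) ∧ (∀ y, ∀ᵐ ω ∂P, Y y 0 ω = y) ∧
  ∃ κ : Kernel (EuclideanSpace ℝ (Fin d)) (EuclideanSpace ℝ (Fin d)), IsMarkovKernel κ ∧
    ∀ y k, ∀ B : Set (EuclideanSpace ℝ (Fin d)), MeasurableSet B →
      P⟦(Y y (k + 1)) ⁻¹' B | ⨆ i : Fin (k + 1), MeasurableSpace.comap (Y y i) inferInstance⟧
        =ᵐ[P] fun ω => (κ (Y y k ω)).real B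

/-- Attractivity: on every compact set `K` of initial values,
`E |x(t, x₀) - x(t, y₀)|ᵖ ≤ |x₀ - y₀|ᵖ e^{-M₁ t}` for some constant `M₁ > 0`. -/
def IsAttractive (P : Measure Ω)
    (x : EuclideanSpace ℝ (Fin d) → ℝ≥0 → Ω → EuclideanSpace ℝ (Fin d)) (p : ℝ) : Prop :=
  ∀ K : Set (EuclideanSpace ℝ (Fin d)), IsCompact K → ∃ M₁ : ℝ, 0 < M₁ ∧
    ∀ x₀ ∈ K, ∀ y₀ ∈ K, ∀ t : ℝ≥0,
      ∫⁻ ω, ‖x x₀ t ω - x y₀ t ω‖ₑ ^ p ∂P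
        ≤ ENNReal.ofReal (‖x₀ - y₀‖ ^ p * Real.exp (-M₁ * t))

/-- Finite-time convergence: for every horizon `T > 0` and every `n ≥ 1` for which the step size
`h = T / n` is admissible, `E |x(jh, x₀) - X_j|ᵖ ≤ C_T Ψ(|x₀|^{r₁}) h^q` for `j = 1, …, n`.
Here `X h x₀ j` is the `j`-th iterate of the method with step size `h` started at `x₀`. -/
def FiniteTimeConvergent (P : Measure Ω)
    (x : EuclideanSpace ℝ (Fin d) → ℝ≥0 → Ω → EuclideanSpace ℝ (Fin d))
    (X : ℝ≥0 → EuclideanSpace ℝ (Fin d) → ℕ → Ω → EuclideanSpace ℝ (Fin d))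
    (hmax : ℝ≥0) (p q r₁ : ℝ) (Ψ : ℝ → ℝ) (C : ℝ≥0 → ℝ) : Prop :=
  ∀ T : ℝ≥0, 0 < T → ∀ n : ℕ, 1 ≤ n → T / n ≤ hmax → ∀ j : ℕ, 1 ≤ j → j ≤ n →
    ∀ x₀ : EuclideanSpace ℝ (Fin d),
      ∫⁻ ω, ‖x x₀ (j * (T / n)) ω - X (T / n) x₀ j ω‖ₑ ^ p ∂P
        ≤ ENNReal.ofReal (C T * Ψ (‖x₀‖ ^ r₁) * ((T / n : ℝ≥0) : ℝ) ^ q)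

/-- Uniform boundedness of the moment of order `r₁` of the numerical solution, with a bound that
depends on the initial value only. -/
def NumericalMomentBounded (P : Measure Ω)
    (X : ℝ≥0 → EuclideanSpace ℝ (Fin d) → ℕ → Ω → EuclideanSpace ℝ (Fin d))
    (hmax : ℝ≥0) (r₁ : ℝ) : Prop :=
  ∀ x₀ : EuclideanSpace ℝ (Fin d), ∃ M₂ : ℝ, ∀ h : ℝ≥0, 0 < h → h ≤ hmax → ∀ k : ℕ,
    ∫⁻ ω, ‖X h x₀ k ω‖ₑ ^ r₁ ∂P ≤ ENNReal.ofReal M₂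

/-- Uniform boundedness of the moment of order `p` of the exact solution, with a bound that
depends on the initial value only. -/
def ExactMomentBounded (P : Measure Ω)
    (x : EuclideanSpace ℝ (Fin d) → ℝ≥0 → Ω → EuclideanSpace ℝ (Fin d)) (p : ℝ) : Prop :=
  ∀ x₀ : EuclideanSpace ℝ (Fin d), ∃ M₅ : ℝ, ∀ t : ℝ≥0,
    ∫⁻ ω, ‖x x₀ t ω‖ₑ ^ p ∂P ≤ ENNReal.ofReal M₅

end Conditions

/-! ### The bounded-Lipschitz metric and stationary distributions -/

section Stationary

variable {Ω : Type*} {mΩ : MeasurableSpace Ω} {d : ℕ}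

/-- The functions `F : ℝᵈ → ℝ` with `|F x - F y| ≤ |x - y|` and `|F x| ≤ 1`. -/
def boundedLipschitz (d : ℕ) : Set (EuclideanSpace ℝ (Fin d) → ℝ) :=
  {F | (∀ x y, |F x - F y| ≤ ‖x - y‖) ∧ ∀ x, |F x| ≤ 1}

/-- The bounded-Lipschitz metric `d_𝕃`, applied to probability measures on `ℝᵈ` (for which the
supremum is over a nonempty set of reals bounded by `2`). -/
def dL (μ ν : Measure (EuclideanSpace ℝ (Fin d))) : ℝ :=
  ⨆ F : boundedLipschitz d, |(∫ y, F.1 y ∂μ) - ∫ y, F.1 y ∂ν|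

/-- `π` is a stationary distribution: for every initial value `x₀`, the law of `x(t, x₀)`
converges to `π` in the metric `d_𝕃` as `t → ∞`. -/
def IsStationaryDistribution (P : Measure Ω)
    (x : EuclideanSpace ℝ (Fin d) → ℝ≥0 → Ω → EuclideanSpace ℝ (Fin d))
    (π : ProbabilityMeasure (EuclideanSpace ℝ (Fin d))) : Prop :=
  ∀ x₀, Tendsto (fun t : ℝ≥0 => dL (P.map (x x₀ t)) (π : Measure (EuclideanSpace ℝ (Fin d))))
    atTop (𝓝 0)

/-- `d_𝕃(law of X_j, π) → 0` as `jh → ∞` and `h → 0`, the step sizes `h` being taken from `H`,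
where `X h x₀ j` is the `j`-th iterate with step size `h` started at `x₀`. -/
def NumericalLawTendsto (P : Measure Ω)
    (X : ℝ≥0 → EuclideanSpace ℝ (Fin d) → ℕ → Ω → EuclideanSpace ℝ (Fin d))
    (π : ProbabilityMeasure (EuclideanSpace ℝ (Fin d))) (x₀ : EuclideanSpace ℝ (Fin d))
    (H : Set ℝ≥0) : Prop :=
  ∀ ε : ℝ, 0 < ε → ∃ τ δ : ℝ≥0, 0 < δ ∧ ∀ h ∈ H, 0 < h → h ≤ δ → ∀ j : ℕ, τ ≤ j * h →
    dL (P.map (X h x₀ j)) (π : Measure (EuclideanSpace ℝ (Fin d))) < ε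

end Stationary

end

/-! ### Bounded Lipschitz test functions and the metric `dL` -/

section BoundedLipschitz

variable {d : ℕ} {F : EuclideanSpace ℝ (Fin d) → ℝ}

/-! No Markov property is available for the exact solution; it is borrowed from the numerical chain
as `h → 0`. To compare the laws at times `t` and `t + s` from `y`, take a grid containing both
times. The chain at `t + s` is close to the exact solution. Restarted after elapsed time `s`, it
runs for time `t` from a random point which, by the moment bound uniform in `h` and `k`, mostly lies
in a fixed ball. From a point `z` of that ball it is close to `x z t`, and attractivity brings `x z
t` close to `x y t` once `t` is large. The threshold for `t` depends only on the ball; `h` is sent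
to `0` afterwards. So the laws are Cauchy (`exists_forall_abs_integral_sub_le_of_le`).

The moment bound on `x` gives tightness, hence a cluster point, which the Cauchy property makes a
limit. Attractivity makes this limit common to all starting points, uniformly on balls.

The numerical limit uses the same restart: only the last stretch, of length `n * h` in a fixed
window, is compared with the exact solution, so finite-time error constants suffice at arbitrarily
late times. -/

lemma boundedLipschitz_lipschitzWith (hF : F ∈ boundedLipschitz d) : LipschitzWith 1 F :=
  LipschitzWith.of_dist_le_mul fun x y => by
    simpa [Real.dist_eq, dist_eq_norm] using hF.1 x y

lemma boundedLipschitz_continuous (hF : F ∈ boundedLipschitz d) : Continuous F :=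
  (boundedLipschitz_lipschitzWith hF).continuous

lemma boundedLipschitz_integrable_comp {Ω : Type*} {mΩ : MeasurableSpace Ω} {P : Measure Ω}
    [IsFiniteMeasure P] {Z : Ω → EuclideanSpace ℝ (Fin d)} (hF : F ∈ boundedLipschitz d)
    (hZ : Measurable Z) : Integrable (fun ω => F (Z ω)) P :=
  Integrable.of_bound ((boundedLipschitz_continuous hF).measurable.comp hZ).aestronglyMeasurable 1
    (ae_of_all _ fun ω => hF.2 (Z ω))

lemma boundedLipschitz_integrable (hF : F ∈ boundedLipschitz d)
    (μ : Measure (EuclideanSpace ℝ (Fin d))) [IsFiniteMeasure μ] : Integrable F μ :=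
  boundedLipschitz_integrable_comp hF measurable_id

lemma boundedLipschitz_abs_integral_le (hF : F ∈ boundedLipschitz d)
    (μ : Measure (EuclideanSpace ℝ (Fin d))) [IsProbabilityMeasure μ] : |∫ y, F y ∂μ| ≤ 1 := by
  simpa [← Real.norm_eq_abs] using
    norm_integral_le_of_norm_le_const (μ := μ) (f := F) (ae_of_all _ hF.2)

lemma zero_mem_boundedLipschitz (d : ℕ) : (fun _ => 0) ∈ boundedLipschitz d :=
  ⟨fun x y => by simp, fun x => by simp⟩

/-- The integrals lie in `[-1, 1]`, so the supremum is over a set bounded by `2` and is not the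
default value of an unbounded real supremum. -/
lemma abs_integral_sub_le_dL (hF : F ∈ boundedLipschitz d)
    (μ ν : Measure (EuclideanSpace ℝ (Fin d))) [IsProbabilityMeasure μ] [IsProbabilityMeasure ν] :
    |(∫ y, F y ∂μ) - ∫ y, F y ∂ν| ≤ dL μ ν := by
  refine le_ciSup (f := fun F : boundedLipschitz d => |(∫ y, F.1 y ∂μ) - ∫ y, F.1 y ∂ν|)
    ⟨2, ?_⟩ ⟨F, hF⟩
  rintro _ ⟨G, rfl⟩
  have h1 := abs_le.1 (boundedLipschitz_abs_integral_le G.2 μ)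
  have h2 := abs_le.1 (boundedLipschitz_abs_integral_le G.2 ν)
  exact abs_le.2 ⟨by linarith, by linarith⟩

lemma dL_le {μ ν : Measure (EuclideanSpace ℝ (Fin d))} {c : ℝ}
    (h : ∀ F ∈ boundedLipschitz d, |(∫ y, F y ∂μ) - ∫ y, F y ∂ν| ≤ c) : dL μ ν ≤ c :=
  have : Nonempty (boundedLipschitz d) := ⟨⟨_, zero_mem_boundedLipschitz d⟩⟩
  ciSup_le fun F => h F.1 F.2

lemma dL_nonneg (μ ν : Measure (EuclideanSpace ℝ (Fin d))) [IsProbabilityMeasure μ]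
    [IsProbabilityMeasure ν] : 0 ≤ dL μ ν :=
  (abs_nonneg _).trans (abs_integral_sub_le_dL (zero_mem_boundedLipschitz d) μ ν)

lemma integral_map_boundedLipschitz {Ω : Type*} {mΩ : MeasurableSpace Ω} {P : Measure Ω}
    {Z : Ω → EuclideanSpace ℝ (Fin d)} (hF : F ∈ boundedLipschitz d) (hZ : Measurable Z) :
    ∫ y, F y ∂(P.map Z) = ∫ ω, F (Z ω) ∂P :=
  integral_map hZ.aemeasurable (boundedLipschitz_continuous hF).aestronglyMeasurable

/-- Bounded Lipschitz functions separate probability measures. -/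
lemma ProbabilityMeasure.eq_of_forall_boundedLipschitz
    {μ ν : ProbabilityMeasure (EuclideanSpace ℝ (Fin d))}
    (h : ∀ F ∈ boundedLipschitz d,
      ∫ y, F y ∂(μ : Measure (EuclideanSpace ℝ (Fin d))) = ∫ y, F y ∂(ν : Measure _)) :
    μ = ν := by
  refine tendsto_nhds_unique (f := fun _ : ℕ => μ) (l := atTop) tendsto_const_nhds ?_
  rw [tendsto_iff_forall_lipschitz_integral_tendsto]
  rintro f ⟨B, hB⟩ ⟨L, hL⟩
  have hB0 : 0 ≤ B := dist_nonneg.trans (hB 0 0)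
  have hc : 0 < 1 + B + L := by positivity
  have hf : ∀ m : ProbabilityMeasure (EuclideanSpace ℝ (Fin d)),
      Integrable f (m : Measure (EuclideanSpace ℝ (Fin d))) := fun m =>
    Integrable.of_bound hL.continuous.aestronglyMeasurable (|f 0| + B) (ae_of_all _ fun y => by
      have := hB y 0
      rw [Real.dist_eq] at this
      have h2 := abs_add_le (f y - f 0) (f 0)
      rw [sub_add_cancel] at h2
      rw [Real.norm_eq_abs]; linarith)
  -- Subtracting `f 0` turns bounded oscillation into a sup bound; dividing by `1 + B + L` then puts
  -- `f` in the test class.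
  have key := h (fun y => (1 + B + L)⁻¹ * (f y - f 0)) ⟨fun y z => by
      have := hL.dist_le_mul y z
      rw [Real.dist_eq, dist_eq_norm] at this
      rw [← mul_sub, sub_sub_sub_cancel_right, abs_mul, abs_of_pos (inv_pos.2 hc),
        inv_mul_le_iff₀ hc]
      exact this.trans (by gcongr; linarith), fun y => by
      have := hB y 0
      rw [Real.dist_eq] at this
      rw [abs_mul, abs_of_pos (inv_pos.2 hc), inv_mul_le_iff₀ hc]
      have := L.2
      simp only [NNReal.val_eq_coe] at this
      linarith⟩
  rw [integral_const_mul, integral_const_mul, integral_sub (hf μ) (integrable_const _),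
    integral_sub (hf ν) (integrable_const _)] at key
  have key' := mul_left_cancel₀ (inv_pos.2 hc).ne' key
  simp only [integral_const, probReal_univ, smul_eq_mul, one_mul, sub_left_inj] at key'
  rw [key']
  exact tendsto_const_nhds

end BoundedLipschitz

/-! ### Consequences of moment bounds -/

section Moments

variable {Ω : Type*} {mΩ : MeasurableSpace Ω} {P : Measure Ω} {d : ℕ}

lemma measureReal_norm_ge_le_of_lintegral_rpow_le {Z : Ω → EuclideanSpace ℝ (Fin d)}
    (hZ : Measurable Z) {p c η : ℝ} (hp : 0 < p) (hc : 0 ≤ c) (hη : 0 < η)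
    (h : ∫⁻ ω, ‖Z ω‖ₑ ^ p ∂P ≤ ENNReal.ofReal c) : P.real {ω | η ≤ ‖Z ω‖} ≤ c / η ^ p := by
  have hηp : 0 < η ^ p := Real.rpow_pos_of_pos hη p
  have hset : {ω | η ≤ ‖Z ω‖} ⊆ {ω | ENNReal.ofReal (η ^ p) ≤ ‖Z ω‖ₑ ^ p} := fun ω hω => by
    simp only [mem_ofPred_eq] at hω ⊢
    rw [← ofReal_norm, ENNReal.ofReal_rpow_of_nonneg (norm_nonneg _) hp.le]
    exact ENNReal.ofReal_le_ofReal (Real.rpow_le_rpow hη.le hω hp.le)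
  have hmark := mul_meas_ge_le_lintegral₀ (μ := P) (hZ.enorm.pow_const p).aemeasurable
    (ENNReal.ofReal (η ^ p))
  have h1 : ENNReal.ofReal (η ^ p) * P {ω | η ≤ ‖Z ω‖} ≤ ENNReal.ofReal c :=
    ((mul_le_mul_right (measure_mono hset) _).trans hmark).trans h
  have h2 := ENNReal.toReal_mono ENNReal.ofReal_ne_top h1
  rw [ENNReal.toReal_mul, ENNReal.toReal_ofReal hηp.le, ENNReal.toReal_ofReal hc] at h2
  rw [le_div_iff₀' hηp]
  exact h2

/-- Off the event that `Z₁`, `Z₂` are at least `ε / 2` apart, `F` changes by at most `ε / 2`; on it,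
by at most `2`. Markov's inequality bounds its probability by `ε / 4`, for any `p > 0`, with `c`
uniform in `F`, `Z₁`, `Z₂`. -/
lemma exists_forall_abs_integral_sub_le (P : Measure Ω) [IsProbabilityMeasure P] {p : ℝ}
    (hp : 0 < p) {ε : ℝ} (hε : 0 < ε) :
    ∃ c : ℝ, 0 < c ∧ ∀ Z₁ Z₂ : Ω → EuclideanSpace ℝ (Fin d), Measurable Z₁ → Measurable Z₂ →
      ∫⁻ ω, ‖Z₁ ω - Z₂ ω‖ₑ ^ p ∂P ≤ ENNReal.ofReal c → ∀ F ∈ boundedLipschitz d,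
        |(∫ ω, F (Z₁ ω) ∂P) - ∫ ω, F (Z₂ ω) ∂P| ≤ ε := by
  have hη : 0 < ε / 2 := by positivity
  have hηp : 0 < (ε / 2) ^ p := Real.rpow_pos_of_pos hη p
  refine ⟨ε / 4 * (ε / 2) ^ p, by positivity, fun Z₁ Z₂ hZ₁ hZ₂ h F hF => ?_⟩
  have hA : MeasurableSet {ω | ε / 2 ≤ ‖Z₁ ω - Z₂ ω‖} :=
    measurableSet_le measurable_const (hZ₁.sub hZ₂).norm
  have htail := measureReal_norm_ge_le_of_lintegral_rpow_le (hZ₁.sub hZ₂) hp (by positivity) hη h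
  rw [mul_div_cancel_right₀ _ hηp.ne'] at htail
  rw [← integral_sub (boundedLipschitz_integrable_comp hF hZ₁)
    (boundedLipschitz_integrable_comp hF hZ₂)]
  have hbound : ∀ ω, ‖F (Z₁ ω) - F (Z₂ ω)‖ ≤
      ε / 2 + {ω | ε / 2 ≤ ‖Z₁ ω - Z₂ ω‖}.indicator (fun _ => (2 : ℝ)) ω := fun ω => by
    by_cases hω : ε / 2 ≤ ‖Z₁ ω - Z₂ ω‖
    · rw [indicator_of_mem (by exact hω), Real.norm_eq_abs]
      have h1 := abs_le.1 (hF.2 (Z₁ ω))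
      have h2 := abs_le.1 (hF.2 (Z₂ ω))
      exact abs_le.2 ⟨by linarith, by linarith⟩
    · rw [indicator_of_notMem (by exact hω), add_zero]
      exact (hF.1 _ _).trans (not_le.1 hω).le
  calc |∫ ω, F (Z₁ ω) - F (Z₂ ω) ∂P|
      ≤ ∫ ω, ε / 2 + {ω | ε / 2 ≤ ‖Z₁ ω - Z₂ ω‖}.indicator (fun _ => (2 : ℝ)) ω ∂P :=
        norm_integral_le_of_norm_le
          ((integrable_const _).add ((integrable_const _).indicator hA)) (ae_of_all _ hbound)
    _ = ε / 2 + 2 * P.real {ω | ε / 2 ≤ ‖Z₁ ω - Z₂ ω‖} := by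
        rw [integral_add (integrable_const _) ((integrable_const _).indicator hA),
          integral_indicator_const _ hA]
        simp [mul_comm]
    _ ≤ ε := by
        have : P.real {ω | ε / 2 ≤ ‖Z₁ ω - Z₂ ω‖} ≤ ε / 4 := htail
        linarith

/-- A moment bound that is uniform over a family gives uniformly small tails. -/
lemma exists_forall_measureReal_norm_ge_le (P : Measure Ω) [IsProbabilityMeasure P] {p : ℝ}
    (hp : 0 < p) (M : ℝ) {ε : ℝ} (hε : 0 < ε) :
    ∃ R : ℝ, 0 < R ∧ ∀ r, R ≤ r → ∀ Z : Ω → EuclideanSpace ℝ (Fin d), Measurable Z →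
      ∫⁻ ω, ‖Z ω‖ₑ ^ p ∂P ≤ ENNReal.ofReal M → P.real {ω | r ≤ ‖Z ω‖} ≤ ε := by
  -- `M` may be nonpositive, hence `max M 1`.
  have hM : 0 < (max M 1) / ε := by positivity
  refine ⟨((max M 1) / ε) ^ p⁻¹, Real.rpow_pos_of_pos hM _, fun r hr Z hZ h => ?_⟩
  have hr0 : 0 < r := (Real.rpow_pos_of_pos hM _).trans_le hr
  refine (measureReal_norm_ge_le_of_lintegral_rpow_le hZ hp (by positivity) hr0
    (h.trans (ENNReal.ofReal_le_ofReal (le_max_left M 1)))).trans ?_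
  have h1 : max M 1 / ε ≤ r ^ p := by
    rwa [Real.rpow_inv_le_iff_of_pos hM.le hr0.le hp] at hr
  rw [div_le_iff₀ (Real.rpow_pos_of_pos hr0 p)]
  rwa [div_le_iff₀' hε] at h1

end Moments

/-! ### Restarting the numerical chain -/

section Markov

variable {Ω : Type*} {mΩ : MeasurableSpace Ω} {P : Measure Ω} [IsProbabilityMeasure P] {d : ℕ}
  {Y : EuclideanSpace ℝ (Fin d) → ℕ → Ω → EuclideanSpace ℝ (Fin d)}

/-- The `n`-step transition kernels of a time-homogeneous Markov process. -/
lemma IsHomogeneousMarkov.exists_kernel (hY : IsHomogeneousMarkov P Y) (n : ℕ) :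
    ∃ K : Kernel (EuclideanSpace ℝ (Fin d)) (EuclideanSpace ℝ (Fin d)),
      (∀ y, P.map (Y y n) = K y) ∧ ∀ y i, P.map (Y y (i + n)) = K ∘ₘ (P.map (Y y i)) := by
  obtain ⟨hmeas, hinit, κ, hκ, hcond⟩ := hY
  have hstep : ∀ y k, P.map (Y y (k + 1)) = κ ∘ₘ (P.map (Y y k)) := fun y k => by
    ext B hB
    have hle : (⨆ i : Fin (k + 1), MeasurableSpace.comap (Y y i) inferInstance) ≤ mΩ :=
      iSup_le fun i => (hmeas y i).comap_le
    -- Taking expectations removes the conditioning: only the evolution of laws is needed.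
    have h1 : ∫ ω, (κ (Y y k ω)).real B ∂P = P.real (Y y (k + 1) ⁻¹' B) := by
      rw [← integral_congr_ae (hcond y k B hB), integral_condExp hle,
        integral_indicator_const _ (hmeas y _ hB)]
      simp
    rw [Measure.bind_apply hB κ.aemeasurable, lintegral_map (κ.measurable_coe hB) (hmeas y k),
      Measure.map_apply (hmeas y _) hB, ← ofReal_measureReal, ← h1,
      ofReal_integral_eq_lintegral_ofReal]
    · simp
    · exact Integrable.of_bound
        ((κ.measurable_coe hB).comp (hmeas y k)).ennreal_toReal.aestronglyMeasurable 1
        (ae_of_all _ fun ω => by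
          rw [Real.norm_of_nonneg measureReal_nonneg]
          exact measureReal_le_one (μ := κ (Y y k ω)) (s := B))
    · exact ae_of_all _ fun ω => measureReal_nonneg
  induction n with
  | zero =>
    refine ⟨Kernel.id, fun y => ?_, fun y i => by simp⟩
    rw [Measure.map_congr (hinit y), Measure.map_const]
    simp [Kernel.id_apply]
  | succ n ih =>
    obtain ⟨K, hK, hK'⟩ := ih
    refine ⟨κ ∘ₖ K, fun y => ?_, fun y i => ?_⟩
    · rw [hstep, hK, Kernel.comp_apply]
    · rw [← add_assoc, hstep, hK', Measure.comp_assoc]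

/-- Chapman–Kolmogorov: the kernel that advances the law by `n` steps also gives the law of `Y z n`
for every `z`. It therefore supplies measurability in `z`, which is what allows restarting at the
random point `Y y i ω`. -/
lemma IsHomogeneousMarkov.integral_step_add (hY : IsHomogeneousMarkov P Y)
    {F : EuclideanSpace ℝ (Fin d) → ℝ} (hF : F ∈ boundedLipschitz d)
    (y : EuclideanSpace ℝ (Fin d)) (i n : ℕ) :
    Measurable (fun z => ∫ ω, F (Y z n ω) ∂P) ∧
    ∫ ω, F (Y y (i + n) ω) ∂P = ∫ ω, ∫ ω', F (Y (Y y i ω) n ω') ∂P ∂P := by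
  obtain ⟨K, hK, hK'⟩ := hY.exists_kernel n
  have hKint : ∀ z, ∫ ω, F (Y z n ω) ∂P = ∫ u, F u ∂(K z) := fun z => by
    rw [← hK, integral_map_boundedLipschitz hF (hY.1 z n)]
  have : IsMarkovKernel K := ⟨fun z => by
    rw [← hK]; exact Measure.isProbabilityMeasure_map (hY.1 z n).aemeasurable⟩
  have hm : Measurable (fun z => ∫ ω, F (Y z n ω) ∂P) := by
    simp_rw [hKint]
    exact ((boundedLipschitz_continuous hF).stronglyMeasurable.integral_kernel).measurable
  refine ⟨hm, ?_⟩
  have := Measure.isProbabilityMeasure_map (μ := P) (hY.1 y i).aemeasurable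
  rw [← integral_map_boundedLipschitz hF (hY.1 y (i + n)), hK',
    Measure.comp_eq_comp_const_apply,
    Kernel.integral_comp (boundedLipschitz_integrable hF _), Kernel.const_apply]
  simp_rw [← hKint]
  exact integral_map (hY.1 y i).aemeasurable hm.aestronglyMeasurable

/-- If the `n`-step expectation of `F` is close to `a` for all starting points in a ball, then the
`(i + n)`-step expectation is close to `a`, up to the probability of being outside the ball after
`i` steps. -/
lemma IsHomogeneousMarkov.abs_integral_add_sub_le (hY : IsHomogeneousMarkov P Y)
    {F : EuclideanSpace ℝ (Fin d) → ℝ} (hF : F ∈ boundedLipschitz d)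
    (y : EuclideanSpace ℝ (Fin d)) (i n : ℕ) {a R ε : ℝ} (ha : |a| ≤ 1) (hε : 0 ≤ ε)
    (h : ∀ z, ‖z‖ ≤ R → |(∫ ω, F (Y z n ω) ∂P) - a| ≤ ε) :
    |(∫ ω, F (Y y (i + n) ω) ∂P) - a| ≤ ε + 2 * P.real {ω | R ≤ ‖Y y i ω‖} := by
  obtain ⟨hm, hint⟩ := hY.integral_step_add hF y i n
  have hA : MeasurableSet {ω | R ≤ ‖Y y i ω‖} :=
    measurableSet_le measurable_const (hY.1 y i).norm
  have hG : ∀ z, |∫ ω, F (Y z n ω) ∂P| ≤ 1 := fun z => by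
    simpa [← Real.norm_eq_abs] using norm_integral_le_of_norm_le_const (μ := P)
      (f := fun ω => F (Y z n ω)) (ae_of_all _ fun ω => hF.2 (Y z n ω))
  have hGint : Integrable (fun ω => ∫ ω', F (Y (Y y i ω) n ω') ∂P) P :=
    Integrable.of_bound (hm.comp (hY.1 y i)).aestronglyMeasurable 1 (ae_of_all _ fun ω => hG _)
  have hbound : ∀ ω, ‖(∫ ω', F (Y (Y y i ω) n ω') ∂P) - a‖ ≤
      ε + {ω | R ≤ ‖Y y i ω‖}.indicator (fun _ => (2 : ℝ)) ω := fun ω => by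
    by_cases hω : R ≤ ‖Y y i ω‖
    · rw [indicator_of_mem (by exact hω), Real.norm_eq_abs]
      have h1 := abs_le.1 (hG (Y y i ω))
      have h2 := abs_le.1 ha
      exact abs_le.2 ⟨by linarith, by linarith⟩
    · rw [indicator_of_notMem (by exact hω), add_zero]
      exact h _ (not_le.1 hω).le
  have hsub : (∫ ω, F (Y y (i + n) ω) ∂P) - a =
      ∫ ω, ((∫ ω', F (Y (Y y i ω) n ω') ∂P) - a) ∂P := by
    rw [hint, integral_sub hGint (integrable_const _)]; simp
  rw [hsub]
  calc |∫ ω, ((∫ ω', F (Y (Y y i ω) n ω') ∂P) - a) ∂P|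
      ≤ ∫ ω, ε + {ω | R ≤ ‖Y y i ω‖}.indicator (fun _ => (2 : ℝ)) ω ∂P :=
        norm_integral_le_of_norm_le
          ((integrable_const _).add ((integrable_const _).indicator hA)) (ae_of_all _ hbound)
    _ = ε + 2 * P.real {ω | R ≤ ‖Y y i ω‖} := by
        rw [integral_add (integrable_const _) ((integrable_const _).indicator hA),
          integral_indicator_const _ hA]
        simp [mul_comm]

end Markov

/-! ### Long-time limits of the exact and numerical laws -/

section Limit

variable {Ω : Type*} {mΩ : MeasurableSpace Ω} {P : Measure Ω} [IsProbabilityMeasure P] {d : ℕ}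
  {x : EuclideanSpace ℝ (Fin d) → ℝ≥0 → Ω → EuclideanSpace ℝ (Fin d)}
  {X : ℝ≥0 → EuclideanSpace ℝ (Fin d) → ℕ → Ω → EuclideanSpace ℝ (Fin d)}
  {hmax : ℝ≥0} {p q r₁ : ℝ} {Ψ : ℝ → ℝ} {C : ℝ≥0 → ℝ}

/-- Solutions started in a ball get close in law, uniformly over the ball. -/
lemma IsAttractive.exists_forall_abs_integral_sub_le (hx : ∀ y t, Measurable (x y t))
    (hp : 0 < p) (hattr : IsAttractive P x p) (R : ℝ) {ε : ℝ} (hε : 0 < ε) :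
    ∃ T₀ : ℝ≥0, 0 < T₀ ∧ ∀ t, T₀ ≤ t → ∀ y z, ‖y‖ ≤ R → ‖z‖ ≤ R → ∀ F ∈ boundedLipschitz d,
      |(∫ ω, F (x y t ω) ∂P) - ∫ ω, F (x z t ω) ∂P| ≤ ε := by
  obtain ⟨c, hc, hcF⟩ := _root_.exists_forall_abs_integral_sub_le (d := d) P hp hε
  obtain ⟨M, hM, hK⟩ := hattr (Metric.closedBall 0 R) (isCompact_closedBall 0 R)
  have hlim : Tendsto (fun t : ℝ≥0 => (2 * |R|) ^ p * Real.exp (-M * t)) atTop (𝓝 0) := by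
    rw [← mul_zero ((2 * |R|) ^ p)]
    refine Tendsto.const_mul _ (Real.tendsto_exp_atBot.comp ?_)
    exact NNReal.tendsto_coe_atTop.2 tendsto_id |>.const_mul_atTop_of_neg (neg_neg_of_pos hM)
  obtain ⟨T, hT⟩ := eventually_atTop.1 (hlim.eventually_le_const hc)
  refine ⟨max T 1, lt_max_of_lt_right one_pos, fun t ht y z hy hz F hF =>
    hcF _ _ (hx y t) (hx z t) ((hK y (by simpa using hy) z (by simpa using hz) t).trans
      (ENNReal.ofReal_le_ofReal (le_trans ?_ (hT t ((le_max_left _ _).trans ht))))) F hF⟩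
  have h1 : ‖y - z‖ ≤ 2 * |R| := by
    have := norm_sub_le y z
    have := le_abs_self R
    linarith
  gcongr

/-- Uniformly over a ball of starting points, the laws of the numerical solution at a time where
`C` is bounded by a given constant are close to those of the exact solution. -/
lemma FiniteTimeConvergent.exists_forall_abs_integral_sub_le (hx : ∀ y t, Measurable (x y t))
    (h_hmax : 0 < hmax) (hX : ∀ h, 0 < h → h ≤ hmax → ∀ y n, Measurable (X h y n))
    (hp : 0 < p) (hq : 0 < q) (hr₁ : 0 < r₁) (hΨ : ContinuousOn Ψ (Ici 0))
    (hconv : FiniteTimeConvergent P x X hmax p q r₁ Ψ C) (B R : ℝ) {ε : ℝ} (hε : 0 < ε) :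
    ∃ δ : ℝ≥0, 0 < δ ∧ δ ≤ hmax ∧ ∀ h, 0 < h → h ≤ δ → ∀ n : ℕ, 1 ≤ n → |C (n * h)| ≤ B →
      ∀ y, ‖y‖ ≤ R → ∀ F ∈ boundedLipschitz d,
        |(∫ ω, F (X h y n ω) ∂P) - ∫ ω, F (x y (n * h) ω) ∂P| ≤ ε := by
  obtain ⟨c, hc, hcF⟩ := _root_.exists_forall_abs_integral_sub_le (d := d) P hp hε
  obtain ⟨S, hS⟩ := (isCompact_Icc (a := (0 : ℝ)) (b := |R| ^ r₁)).exists_bound_of_continuousOn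
    (hΨ.mono fun u hu => hu.1)
  -- `S` bounds `Ψ` on the ball. Absolute values and `+ 1` keep the divisor positive, and `δ` is
  -- chosen so that `D * δ ^ q ≤ c`, where `D` is this product.
  have hD : 0 < (|B| + 1) * (|S| + 1) := by positivity
  have hcD : 0 < c / ((|B| + 1) * (|S| + 1)) := by positivity
  have hδ : 0 < (c / ((|B| + 1) * (|S| + 1))) ^ q⁻¹ := Real.rpow_pos_of_pos hcD _
  refine ⟨min hmax ⟨_, hδ.le⟩, lt_min h_hmax hδ, min_le_left _ _,
    fun h h0 hh n hn hC y hy F hF => ?_⟩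
  have hhm : h ≤ hmax := hh.trans (min_le_left _ _)
  have hnh : ((n * h : ℝ≥0) / n) = h :=
    mul_div_cancel_left₀ h (by positivity)
  -- The horizon is `n * h` itself, and only its last grid point is used.
  have key := hconv (n * h) (by positivity) n hn (by rwa [hnh]) n hn le_rfl y
  rw [hnh] at key
  rw [abs_sub_comm]
  refine hcF _ _ (hx _ _) (hX h h0 hhm y n) (key.trans (ENNReal.ofReal_le_ofReal ?_)) F hF
  have hΨy : |Ψ (‖y‖ ^ r₁)| ≤ |S| + 1 := by
    have := hS (‖y‖ ^ r₁) ⟨by positivity,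
      Real.rpow_le_rpow (norm_nonneg _) (hy.trans (le_abs_self R)) hr₁.le⟩
    rw [Real.norm_eq_abs] at this
    have := le_abs_self S
    linarith
  have hCB : |C (n * h)| ≤ |B| + 1 := by
    have := le_abs_self B
    linarith
  have hhq : (h : ℝ) ^ q ≤ c / ((|B| + 1) * (|S| + 1)) :=
    (Real.le_rpow_inv_iff_of_pos h.2 hcD.le hq).1 (hh.trans (min_le_right _ _))
  have hhq0 : 0 ≤ (h : ℝ) ^ q := Real.rpow_nonneg h.2 q
  calc C (n * h) * Ψ (‖y‖ ^ r₁) * (h : ℝ) ^ q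
      ≤ |C (n * h) * Ψ (‖y‖ ^ r₁)| * (h : ℝ) ^ q :=
        mul_le_mul_of_nonneg_right (le_abs_self _) hhq0
    _ ≤ ((|B| + 1) * (|S| + 1)) * (c / ((|B| + 1) * (|S| + 1))) := by
        rw [abs_mul]; gcongr
    _ = c := mul_div_cancel₀ _ hD.ne'

lemma continuous_integral_boundedLipschitz {z : ℝ≥0 → Ω → EuclideanSpace ℝ (Fin d)}
    (hz : ∀ t, Measurable (z t)) (hcont : ∀ᵐ ω ∂P, Continuous fun t => z t ω)
    {F : EuclideanSpace ℝ (Fin d) → ℝ} (hF : F ∈ boundedLipschitz d) :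
    Continuous fun t => ∫ ω, F (z t ω) ∂P :=
  continuous_of_dominated (bound := fun _ => 1)
    (fun t => (boundedLipschitz_integrable_comp hF (hz t)).aestronglyMeasurable)
    (fun _ => ae_of_all _ fun _ => hF.2 _) (integrable_const _)
    (hcont.mono fun _ hω => (boundedLipschitz_continuous hF).comp hω)

/-- For such `s`, the times `t` and `t + s` are commensurable and so lie on common grids of
arbitrarily small step. -/
lemma dense_setOf_mul_nat_eq_mul_nat {t : ℝ≥0} (ht : 0 < t) :
    Dense {s : ℝ≥0 | ∃ a b : ℕ, 0 < a ∧ 0 < b ∧ b * s = a * t} := by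
  rw [dense_iff_exists_between]
  intro u v huv
  obtain ⟨r, hr1, hr2⟩ := exists_rat_btwn (show ((u / t : ℝ≥0) : ℝ) < (v / t : ℝ≥0) from
    NNReal.coe_lt_coe.2 (div_lt_div_of_pos_right huv ht))
  have hr0 : 0 < r := by
    have : (0 : ℝ) < r := (NNReal.coe_nonneg _).trans_lt hr1
    exact_mod_cast this
  have hnum : ((r.num.toNat : ℕ) : ℝ) = (r.num : ℝ) := by
    exact_mod_cast Int.toNat_of_nonneg (Rat.num_pos.2 hr0).le
  have hden : (0 : ℝ≥0) < r.den := by exact_mod_cast r.den_pos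
  have hval : (((r.num.toNat : ℝ≥0) / r.den : ℝ≥0) : ℝ) = r := by
    push_cast
    rw [hnum]
    exact_mod_cast Rat.num_div_den r
  rw [← hval, NNReal.coe_lt_coe] at hr1 hr2
  refine ⟨(r.num.toNat : ℝ≥0) / r.den * t, ⟨r.num.toNat, r.den, ?_, r.den_pos, ?_⟩, ?_, ?_⟩
  · have := Rat.num_pos.2 hr0
    omega
  · rw [← mul_assoc, mul_div_cancel₀ _ hden.ne']
  · exact (div_lt_iff₀ ht).1 hr1
  · exact (lt_div_iff₀ ht).1 hr2

/-- The laws of the exact solution form a Cauchy family, uniformly over the test functions. The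
Markov property is only used for the numerical solution, which approximates the exact one when the
step size tends to `0`. -/
lemma exists_forall_abs_integral_sub_le_of_le (hx : ∀ y t, Measurable (x y t))
    (hcont : ∀ y, ∀ᵐ ω ∂P, Continuous fun t => x y t ω) (h_hmax : 0 < hmax)
    (hX_markov : ∀ h : ℝ≥0, 0 < h → h ≤ hmax → IsHomogeneousMarkov P (X h))
    (hp : 0 < p) (hq : 0 < q) (hr₁ : 0 < r₁) (hΨ : ContinuousOn Ψ (Ici 0))
    (hattr : IsAttractive P x p) (hconv : FiniteTimeConvergent P x X hmax p q r₁ Ψ C)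
    (hmom : NumericalMomentBounded P X hmax r₁) (y : EuclideanSpace ℝ (Fin d)) {ε : ℝ}
    (hε : 0 < ε) :
    ∃ T₀ : ℝ≥0, 0 < T₀ ∧ ∀ t, T₀ ≤ t → ∀ u, t ≤ u → ∀ F ∈ boundedLipschitz d,
      |(∫ ω, F (x y u ω) ∂P) - ∫ ω, F (x y t ω) ∂P| ≤ ε := by
  have hX : ∀ h, 0 < h → h ≤ hmax → ∀ y n, Measurable (X h y n) :=
    fun h h0 hh => (hX_markov h h0 hh).1
  have hε6 : 0 < ε / 6 := by positivity
  obtain ⟨M, hM⟩ := hmom y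
  obtain ⟨R₀, -, hR₀⟩ := exists_forall_measureReal_norm_ge_le (d := d) P hr₁ M hε6
  -- The ball must also contain `y`, for attractivity to compare `z` with `y`.
  set R := max R₀ ‖y‖
  obtain ⟨T₀, hT₀, hattr'⟩ := hattr.exists_forall_abs_integral_sub_le hx hp R hε6
  refine ⟨T₀, hT₀, fun t ht u htu F hF => ?_⟩
  obtain ⟨s, rfl⟩ := exists_add_of_le htu
  have ht0 : 0 < t := hT₀.trans_le ht
  -- By path continuity the estimate is closed in `s`, so rational multiples of `t` suffice.
  have hclosed : IsClosed {s : ℝ≥0 | |(∫ ω, F (x y (t + s) ω) ∂P) - ∫ ω, F (x y t ω) ∂P| ≤ ε} :=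
    isClosed_le ((((continuous_integral_boundedLipschitz (hx y) (hcont y) hF).comp
      (continuous_const.add continuous_id)).sub continuous_const).abs) continuous_const
  refine (hclosed.closure_subset_iff.2 ?_ (dense_setOf_mul_nat_eq_mul_nat ht0 s))
  rintro s ⟨a, b, ha, hb, hab⟩
  -- `t` and `s` are fixed before `δ`, so `C` is needed at two horizons only, without any
  -- regularity.
  obtain ⟨δ, hδ, hδm, hδF⟩ := hconv.exists_forall_abs_integral_sub_le hx h_hmax hX hp hq hr₁ hΨ
    (max |C t| |C (t + s)|) R hε6
  obtain ⟨N, hN⟩ := exists_nat_ge (t / b / δ)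
  have hb0 : (0 : ℝ≥0) < b := by exact_mod_cast hb
  have hN0 : (0 : ℝ≥0) < N := (by positivity : 0 < t / b / δ).trans_le hN
  have hN0' : 0 < N := by exact_mod_cast hN0
  have hh0 : 0 < t / b / N := by positivity
  have hhδ : t / b / N ≤ δ := by
    rw [div_le_iff₀ hN0]
    rwa [div_le_iff₀ hδ, mul_comm] at hN
  -- With `h = t / (b * N)`, time `t` is step `b * N` and time `s` is step `a * N`.
  have hn : ((b * N : ℕ) : ℝ≥0) * (t / b / N) = t := by
    push_cast; field_simp
  have hs : s = a * t / b := by rw [← hab]; field_simp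
  have hm : ((a * N + b * N : ℕ) : ℝ≥0) * (t / b / N) = t + s := by
    rw [hs]; push_cast; field_simp; ring
  have hbN : 1 ≤ b * N := Nat.mul_pos hb hN0'
  have hfar := hδF _ hh0 hhδ (a * N + b * N) (by omega) (by rw [hm]; exact le_max_right _ _) y
    (le_max_right _ _) F hF
  rw [hm] at hfar
  have hnear : ∀ z, ‖z‖ ≤ R → |(∫ ω, F (X (t / b / N) z (b * N) ω) ∂P) - ∫ ω, F (x y t ω) ∂P|
      ≤ ε / 6 + ε / 6 := fun z hz => by
    have h1 := hδF _ hh0 hhδ (b * N) hbN (by rw [hn]; exact le_max_left _ _) z hz F hF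
    rw [hn] at h1
    exact (abs_sub_le _ _ _).trans (add_le_add h1 (hattr' t ht z y hz (le_max_right _ _) F hF))
  have habs : |∫ ω, F (x y t ω) ∂P| ≤ 1 := by
    have := Measure.isProbabilityMeasure_map (μ := P) (hx y t).aemeasurable
    rw [← integral_map_boundedLipschitz hF (hx y t)]
    exact boundedLipschitz_abs_integral_le hF _
  have hstep := (hX_markov _ hh0 (hhδ.trans hδm)).abs_integral_add_sub_le hF y (a * N) (b * N)
    habs (by positivity) hnear
  have htail := hR₀ R (le_max_left _ _) _ (hX _ hh0 (hhδ.trans hδm) y (a * N))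
    (hM _ hh0 (hhδ.trans hδm) (a * N))
  have := abs_sub_le (∫ ω, F (x y (t + s) ω) ∂P)
    (∫ ω, F (X (t / b / N) y (a * N + b * N) ω) ∂P) (∫ ω, F (x y t ω) ∂P)
  rw [abs_sub_comm] at hfar
  show |(∫ ω, F (x y (t + s) ω) ∂P) - ∫ ω, F (x y t ω) ∂P| ≤ ε
  -- Budget in sixths of `ε`: one from `hfar`, two from `hnear`, two from the tail.
  linarith

/-- If the laws of `z t` are tight and Cauchy in the bounded-Lipschitz sense, they converge. -/
lemma exists_probabilityMeasure_forall_abs_integral_sub_le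
    {z : ℝ≥0 → Ω → EuclideanSpace ℝ (Fin d)} (hz : ∀ t, Measurable (z t)) (hp : 0 < p) {M : ℝ}
    (hM : ∀ t, ∫⁻ ω, ‖z t ω‖ₑ ^ p ∂P ≤ ENNReal.ofReal M)
    (hcauchy : ∀ ε : ℝ, 0 < ε → ∃ T₀ : ℝ≥0, 0 < T₀ ∧ ∀ t, T₀ ≤ t → ∀ u, t ≤ u →
      ∀ F ∈ boundedLipschitz d, |(∫ ω, F (z u ω) ∂P) - ∫ ω, F (z t ω) ∂P| ≤ ε) :
    ∃ π : ProbabilityMeasure (EuclideanSpace ℝ (Fin d)), ∀ ε : ℝ, 0 < ε → ∃ T₀ : ℝ≥0, ∀ t, T₀ ≤ t →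
      ∀ F ∈ boundedLipschitz d,
        |(∫ ω, F (z t ω) ∂P) - ∫ u, F u ∂(π : Measure (EuclideanSpace ℝ (Fin d)))| ≤ ε := by
  let ν : ℝ≥0 → ProbabilityMeasure (EuclideanSpace ℝ (Fin d)) := fun t =>
    ⟨P.map (z t), Measure.isProbabilityMeasure_map (hz t).aemeasurable⟩
  have htight : IsTightMeasureSet
      {((μ : ProbabilityMeasure (EuclideanSpace ℝ (Fin d))) :
        Measure (EuclideanSpace ℝ (Fin d))) | μ ∈ range ν} := by
    rw [isTightMeasureSet_iff_exists_isCompact_measure_compl_le]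
    intro ε hε
    obtain ⟨e, he0, he⟩ := ENNReal.lt_iff_exists_nnreal_btwn.1 hε
    have he0' : 0 < (e : ℝ) := by exact_mod_cast he0
    rw [← ENNReal.ofReal_coe_nnreal] at he
    obtain ⟨R, -, hR⟩ := exists_forall_measureReal_norm_ge_le (d := d) P hp M he0'
    refine ⟨Metric.closedBall 0 R, isCompact_closedBall 0 R, ?_⟩
    rintro _ ⟨_, ⟨t, rfl⟩, rfl⟩
    refine le_trans ?_ he.le
    change P.map (z t) _ ≤ _
    rw [Measure.map_apply (hz t) Metric.isClosed_closedBall.measurableSet.compl]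
    have hsub : z t ⁻¹' (Metric.closedBall 0 R)ᶜ ⊆ {ω | R ≤ ‖z t ω‖} := fun ω hω => by
      simp only [mem_preimage, mem_compl_iff, mem_closedBall_zero_iff, not_le] at hω
      exact hω.le
    refine (measure_mono hsub).trans ?_
    rw [← ofReal_measureReal]
    exact ENNReal.ofReal_le_ofReal (hR R le_rfl _ (hz t) (hM t))
  -- Along an ultrafilter finer than `atTop`, Prokhorov compactness gives a limit of the laws
  -- directly.
  let U : Ultrafilter ℝ≥0 := Ultrafilter.of atTop
  have hU : (U : Filter ℝ≥0) ≤ atTop := Ultrafilter.of_le _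
  obtain ⟨π, -, hπ⟩ := isCompact_iff_ultrafilter_le_nhds.1
    (isCompact_closure_of_isTightMeasureSet htight) (U.map ν)
    (le_principal_iff.2 (mem_map.2 (univ_mem' fun t => subset_closure ⟨t, rfl⟩)))
  have hlim : Tendsto ν U (𝓝 π) := hπ
  refine ⟨π, fun ε hε => ?_⟩
  obtain ⟨T₀, -, hT₀⟩ := hcauchy ε hε
  refine ⟨T₀, fun t ht F hF => ?_⟩
  have hFlim := (ProbabilityMeasure.tendsto_iff_forall_integral_tendsto.1 hlim)
    (BoundedContinuousFunction.ofNormedAddCommGroup F (boundedLipschitz_continuous hF) 1 hF.2)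
  have hFlim' : Tendsto (fun u => ∫ ω, F (z u ω) ∂P) U
      (𝓝 (∫ u, F u ∂(π : Measure (EuclideanSpace ℝ (Fin d))))) := by
    refine hFlim.congr fun u => ?_
    exact integral_map_boundedLipschitz hF (hz u)
  rw [abs_sub_comm]
  -- With `t` fixed, let the later time `u` tend to infinity along `U` in the Cauchy estimate.
  refine le_of_tendsto ((hFlim'.sub_const _).abs) (hU ?_)
  filter_upwards [eventually_ge_atTop t] with u hu using hT₀ t ht u hu F hF

/-- Convergence of the laws of the numerical solution, given that for each `T₀` there is a time
`n * h` in a fixed interval `[T₀, T₁]` at which `C` is bounded uniformly in `h`. -/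
lemma numericalLawTendsto_of_exists_nat {π : ProbabilityMeasure (EuclideanSpace ℝ (Fin d))}
    {H : Set ℝ≥0} (hx : ∀ y t, Measurable (x y t)) (h_hmax : 0 < hmax)
    (hX_markov : ∀ h : ℝ≥0, 0 < h → h ≤ hmax → IsHomogeneousMarkov P (X h))
    (hp : 0 < p) (hq : 0 < q) (hr₁ : 0 < r₁) (hΨ : ContinuousOn Ψ (Ici 0))
    (hconv : FiniteTimeConvergent P x X hmax p q r₁ Ψ C)
    (hmom : NumericalMomentBounded P X hmax r₁)
    (hπ : ∀ R ε : ℝ, 0 < ε → ∃ T₀ : ℝ≥0, ∀ t, T₀ ≤ t → ∀ y, ‖y‖ ≤ R → ∀ F ∈ boundedLipschitz d,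
      |(∫ ω, F (x y t ω) ∂P) - ∫ u, F u ∂(π : Measure (EuclideanSpace ℝ (Fin d)))| ≤ ε)
    (hH : ∀ T₀ : ℝ≥0, ∃ (T₁ δ₀ : ℝ≥0) (B : ℝ), 0 < δ₀ ∧ ∀ h ∈ H, 0 < h → h ≤ δ₀ →
      ∃ n : ℕ, 1 ≤ n ∧ T₀ ≤ n * h ∧ n * h ≤ T₁ ∧ |C (n * h)| ≤ B)
    (x₀ : EuclideanSpace ℝ (Fin d)) : NumericalLawTendsto P X π x₀ H := by
  intro ε hε
  have hX : ∀ h, 0 < h → h ≤ hmax → ∀ y n, Measurable (X h y n) :=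
    fun h h0 hh => (hX_markov h h0 hh).1
  have hε6 : 0 < ε / 6 := by positivity
  obtain ⟨M, hM⟩ := hmom x₀
  obtain ⟨R, -, hR⟩ := exists_forall_measureReal_norm_ge_le (d := d) P hr₁ M hε6
  obtain ⟨T₀, hT₀⟩ := hπ R (ε / 6) hε6
  obtain ⟨T₁, δ₀, B, hδ₀, hn⟩ := hH T₀
  obtain ⟨δ, hδ, hδm, hδF⟩ := hconv.exists_forall_abs_integral_sub_le hx h_hmax hX hp hq hr₁ hΨ
    B R hε6
  refine ⟨T₁, min δ₀ δ, lt_min hδ₀ hδ, fun h hh h0 hhδ j hj => ?_⟩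
  have hhδ' : h ≤ δ := hhδ.trans (min_le_right _ _)
  have hhm : h ≤ hmax := hhδ'.trans hδm
  obtain ⟨n, hn1, hnT₀, hnT₁, hnC⟩ := hn h hh h0 (hhδ.trans (min_le_left _ _))
  have hnj : n ≤ j := by
    have := le_of_mul_le_mul_right (hnT₁.trans hj) h0
    exact_mod_cast this
  -- The first `i` steps cost only a tail probability, however large `i` is.
  obtain ⟨i, rfl⟩ := Nat.exists_eq_add_of_le' hnj
  refine lt_of_le_of_lt (dL_le (c := ε / 6 + ε / 6 + 2 * (ε / 6)) fun F hF => ?_) (by linarith)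
  rw [integral_map_boundedLipschitz hF (hX h h0 hhm x₀ _)]
  refine ((hX_markov h h0 hhm).abs_integral_add_sub_le hF x₀ i n (R := R)
    (boundedLipschitz_abs_integral_le hF _) (by positivity) fun z hz => ?_).trans
    (add_le_add le_rfl (mul_le_mul_of_nonneg_left
      (hR R le_rfl _ (hX h h0 hhm x₀ i) (hM h h0 hhm i)) zero_le_two))
  exact (abs_sub_le _ _ _).trans
    (add_le_add (hδF h h0 hhδ' n hn1 hnC z hz F hF) (hT₀ _ hnT₀ z hz F hF))

end Limit

/-! ### Stationary distribution and its numerical approximation -/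

theorem theorem2p5 {d : ℕ} {Ω : Type*} {mΩ : MeasurableSpace Ω}
    (P : Measure Ω) [IsProbabilityMeasure P] [P.IsComplete]
    (𝓕 : Filtration ℝ≥0 mΩ) [𝓕.IsRightContinuous]
    (h_null : ∀ N : Set Ω, P N = 0 → MeasurableSet[𝓕 0] N)
    (W : ℝ≥0 → Ω → ℝ) (hW : IsBrownianMotionWrt 𝓕 W P)
    (f g : EuclideanSpace ℝ (Fin d) → EuclideanSpace ℝ (Fin d))
    (hf : Measurable f) (hg : Measurable g)
    -- the underlying solutions `x(t, x₀)`
    (x : EuclideanSpace ℝ (Fin d) → ℝ≥0 → Ω → EuclideanSpace ℝ (Fin d))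
    (hx : ∀ x₀, IsSDESolution 𝓕 W P f g x₀ (x x₀))
    -- the numerical solutions: `X h x₀ j` is the `j`-th iterate with step size `h ∈ (0, hmax]`
    (hmax : ℝ≥0) (h_hmax : 0 < hmax)
    (X : ℝ≥0 → EuclideanSpace ℝ (Fin d) → ℕ → Ω → EuclideanSpace ℝ (Fin d))
    (hX_markov : ∀ h : ℝ≥0, 0 < h → h ≤ hmax → IsHomogeneousMarkov P (X h))
    (p q r₁ : ℝ) (hp : 0 < p) (hq : 0 < q) (hr₁ : 0 < r₁)
    (Ψ : ℝ → ℝ) (hΨ : ContinuousOn Ψ (Ici 0)) (C : ℝ≥0 → ℝ)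
    (hx_attr : IsAttractive P x p)
    (hX_conv : FiniteTimeConvergent P x X hmax p q r₁ Ψ C)
    (hX_mom : NumericalMomentBounded P X hmax r₁)
    (hx_mom : ExactMomentBounded P x p) :
    (∃! π : ProbabilityMeasure (EuclideanSpace ℝ (Fin d)), IsStationaryDistribution P x π) ∧
    ∀ π : ProbabilityMeasure (EuclideanSpace ℝ (Fin d)), IsStationaryDistribution P x π →
      ∀ x₀ : EuclideanSpace ℝ (Fin d),
        -- step sizes `h = T / n` for a fixed `T`
        (∀ T : ℝ≥0, 0 < T →
          NumericalLawTendsto P X π x₀ {h | ∃ n : ℕ, 1 ≤ n ∧ h = T / n}) ∧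
        -- arbitrary step sizes, when `C_T` is bounded on compact sets of horizons `T`
        ((∀ a b : ℝ≥0, 0 < a → Bornology.IsBounded (C '' Icc a b)) →
          NumericalLawTendsto P X π x₀ univ) := by
  have hxm : ∀ y t, Measurable (x y t) := fun y t =>
    (((hx y).adapted t).mono (𝓕.le t)).measurable
  have hlaw : ∀ y t, IsProbabilityMeasure (P.map (x y t)) := fun y t =>
    Measure.isProbabilityMeasure_map (hxm y t).aemeasurable
  obtain ⟨M, hM⟩ := hx_mom 0
  obtain ⟨π₀, hπ₀⟩ := exists_probabilityMeasure_forall_abs_integral_sub_le (hxm 0) hp hM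
    fun ε hε => exists_forall_abs_integral_sub_le_of_le hxm (fun y => (hx y).continuous) h_hmax
      hX_markov hp hq hr₁ hΨ hx_attr hX_conv hX_mom 0 hε
  have hunif : ∀ R ε : ℝ, 0 < ε → ∃ T₀ : ℝ≥0, ∀ t, T₀ ≤ t → ∀ y, ‖y‖ ≤ R →
      ∀ F ∈ boundedLipschitz d, |(∫ ω, F (x y t ω) ∂P)
        - ∫ u, F u ∂(π₀ : Measure (EuclideanSpace ℝ (Fin d)))| ≤ ε := fun R ε hε => by
    obtain ⟨T₁, hT₁⟩ := hπ₀ (ε / 2) (by positivity)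
    obtain ⟨T₂, -, hT₂⟩ := hx_attr.exists_forall_abs_integral_sub_le hxm hp R
      (show 0 < ε / 2 by positivity)
    refine ⟨max T₁ T₂, fun t ht y hy F hF => (abs_sub_le _ (∫ ω, F (x 0 t ω) ∂P) _).trans ?_⟩
    have h1 := hT₁ t ((le_max_left _ _).trans ht) F hF
    have h2 := hT₂ t ((le_max_right _ _).trans ht) y 0 hy
      (by simpa using (norm_nonneg y).trans hy) F hF
    linarith
  have hstat : IsStationaryDistribution P x π₀ := fun y => by
    rw [Metric.tendsto_atTop]
    intro ε hε
    obtain ⟨T₀, hT₀⟩ := hunif ‖y‖ (ε / 2) (by positivity)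
    refine ⟨T₀, fun t ht => ?_⟩
    have := hlaw y t
    rw [Real.dist_eq, sub_zero, abs_of_nonneg (dL_nonneg _ _)]
    refine (dL_le fun F hF => ?_).trans_lt (half_lt_self hε)
    rw [integral_map_boundedLipschitz hF (hxm y t)]
    exact hT₀ t ht y le_rfl F hF
  have htend : ∀ π : ProbabilityMeasure (EuclideanSpace ℝ (Fin d)),
      IsStationaryDistribution P x π → ∀ F ∈ boundedLipschitz d,
      Tendsto (fun t : ℝ≥0 => ∫ u, F u ∂(P.map (x 0 t))) atTop
        (𝓝 (∫ u, F u ∂(π : Measure (EuclideanSpace ℝ (Fin d))))) := fun π hπ F hF => by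
    refine tendsto_iff_dist_tendsto_zero.2 (squeeze_zero (fun _ => dist_nonneg) (fun t => ?_)
      (hπ 0))
    have := hlaw 0 t
    exact abs_integral_sub_le_dL hF _ _
  have huniq : ∀ π : ProbabilityMeasure (EuclideanSpace ℝ (Fin d)),
      IsStationaryDistribution P x π → π = π₀ := fun π hπ =>
    ProbabilityMeasure.eq_of_forall_boundedLipschitz fun F hF =>
      tendsto_nhds_unique (htend π hπ F hF) (htend π₀ hstat F hF)
  refine ⟨⟨π₀, hstat, huniq⟩, fun π hπ x₀ => ?_⟩
  obtain rfl := huniq π hπ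
  refine ⟨fun T hT => ?_, fun hC => ?_⟩
  · refine numericalLawTendsto_of_exists_nat hxm h_hmax hX_markov hp hq hr₁ hΨ hX_conv hX_mom hunif
      (fun T₀ => ?_) x₀
    obtain ⟨m, hm⟩ := exists_nat_ge (T₀ / T)
    have hm' : T₀ ≤ (m + 1 : ℕ) * T := by
      refine ((div_le_iff₀ hT).1 hm).trans ?_
      gcongr
      omega
    -- Since `h` divides `T`, every grid hits the single horizon `(m + 1) * T`, so one value of `C`
    -- suffices. The bound `1` on `h` plays no role.
    refine ⟨(m + 1 : ℕ) * T, 1, |C ((m + 1 : ℕ) * T)|, one_pos, ?_⟩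
    rintro _ ⟨n, hn, rfl⟩ - -
    have hn0 : (n : ℝ≥0) ≠ 0 := by positivity
    have heq : (((m + 1) * n : ℕ) : ℝ≥0) * (T / n) = (m + 1 : ℕ) * T := by
      push_cast; field_simp
    exact ⟨(m + 1) * n, Nat.mul_pos m.succ_pos hn, by rwa [heq], heq.le, by rw [heq]⟩
  · refine numericalLawTendsto_of_exists_nat hxm h_hmax hX_markov hp hq hr₁ hΨ hX_conv hX_mom hunif
      (fun T₀ => ?_) x₀
    -- The window starts at `T₀ + 1` because `T₀` may be `0` while `C` is controlled only away from
    -- `0`; for `h ≤ 1`, rounding up stays below `T₀ + 2`.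
    obtain ⟨B, hB⟩ := (hC (T₀ + 1) (T₀ + 2) (by positivity)).exists_norm_le
    refine ⟨T₀ + 2, 1, B, one_pos, fun h _ h0 h1 => ?_⟩
    have hpos : 0 < (T₀ + 1) / h := by positivity
    have hlow : T₀ + 1 ≤ ⌈(T₀ + 1) / h⌉₊ * h := (div_le_iff₀ h0).1 (Nat.le_ceil _)
    have hupp : ⌈(T₀ + 1) / h⌉₊ * h ≤ T₀ + 2 := by
      calc (⌈(T₀ + 1) / h⌉₊ : ℝ≥0) * h ≤ ((T₀ + 1) / h + 1) * h := by
            gcongr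
            exact (Nat.ceil_lt_add_one hpos.le).le
        _ = T₀ + 1 + h := by field_simp
        _ ≤ T₀ + 1 + 1 := by gcongr
        _ = T₀ + 2 := by ring
    exact ⟨⌈(T₀ + 1) / h⌉₊, Nat.ceil_pos.2 hpos, le_self_add.trans hlow, hupp,
      hB _ (mem_image_of_mem C ⟨hlow, hupp⟩)⟩
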